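/- **Conventions.** Letters come from a countably infinite alphabet; words are finite sequences of letters, and $\lambda$ is the empty word. A monoid satisfies an identity $\mathbf u\approx\mathbf v$ if both sides are equal under every assignment of its elements to the letters; $\operatorname{var}\Sigma$ is the class of all monoids satisfying all identities in $\Sigma$; an identity holds in a class if all monoids of the class satisfy it; it is non-trivial if $\mathbf u\neq\mathbf v$ as words. Let $$\Phi=\{xyx\approx xyx^2,\ x^2y^2\approx y^2x^2,\ x^2y\approx x^2yx\},\qquad \mathbf K=\operatorname{var}\Phi,$$ and, for every integer $k\ge 1$, let $\mathbf F_k=\operatorname{var}(\Phi\cup\{\alpha_k\})$, where $$\alpha_k:\ x_ky_kx_{k-1}x_ky_k\mathbf b_{k-1}\approx y_kx_kx_{k-1}x_ky_k\mathbf b_{k-1},\qquad \mathbf b_0=\lambda,\quad \mathbf b_s=x_{s-1}x_s\,x_{s-2}x_{s-1}\cdots x_0x_1 .$$ For a word $\mathbf w$ let $\operatorname{con}(\mathbf w)$, $\operatorname{sim}(\mathbf w)$ and $\operatorname{mul}(\mathbf w)$ be the sets of letters that occur in $\mathbf w$ at least once, exactly once, and at least twice, respectively. The $k$-decomposition $\mathbf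 w=t_0\mathbf w_0t_1\mathbf w_1\cdots t_m\mathbf w_m$ of $\mathbf w$ into $k$-dividers $t_0=\lambda,t_1,\dots,t_m$ (where $t_1,\dots,t_m$ are letters) and possibly empty $k$-blocks $\mathbf w_0,\dots,\mathbf w_m$ is defined by induction on $k\ge 0$: for $k=0$, the letters $t_1,\dots,t_m$ are the simple letters of $\mathbf w$ in the order of their occurrence; the $(k+1)$-decomposition is obtained from the $k$-decomposition by turning into dividers, in each $k$-block $\mathbf w_i$, all letters that occur exactly once in $\mathbf w_i$ and do not occur in $\mathbf w$ to the left of $\mathbf w_i$. For a letter $x$ and $1\le i\le$ the number of occurrences of $x$ in $\mathbf w$, the restrictor $h_i^k(\mathbf w,x)$ is the right-most $k$-divider of $\mathbf w$ that strictly precedes the $i$-th occurrence of $x$ in $\mathbf w$ (it may be $t_0=\lambda$). **Proposition.** For words $\mathbf u,\mathbf v$ consider the conditions (A) $\operatorname{sim}(\mathbf u)=\operatorname{sim}(\mathbf v)$ and $\operatorname{mul}(\mathbf u)=\operatorname{mul}(\mathbf v)$; (B$_\ell$) $h_i^{\ell-1}(\mathbf u,x)=h_i^{\ell-1}(\mathbf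 v,x)$ for $i=1,2$ and all $x\in\operatorname{con}(\mathbf u)$, where the equality for $i$ is required only if $x$ occurs at least $i$ times in both words. Let $\mathbf u\approx\mathbf v$ be a non-trivial identity. (i) For every $k\ge 1$, the identity $\mathbf u\approx\mathbf v$ holds in $\mathbf F_k$ if and only if (A) and (B$_k$) are true. (ii) The identity $\mathbf u\approx\mathbf v$ holds in $\mathbf K$ if and only if (A) and (B$_\ell$) for all $\ell\ge 1$ are true. -/

import Mathlib

namespace MonoidWords

/-! ### Words, identities, varieties of monoids -/

/-- The countably infinite alphabet. -/
abbrev Letter : Type := ℕ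

/-- Possibly empty words; the empty word is `1`. -/
abbrev Word : Type := FreeMonoid Letter

/-- An identity `u ≈ v`, given by the pair `(u, v)`. -/
abbrev Identity : Type := Word × Word

/-- The monoid `M` satisfies `u ≈ v`: both sides take the same value under every assignment of
elements of `M` to the letters. -/
def Satisfies (M : Type*) [Monoid M] (e : Identity) : Prop :=
  ∀ φ : Letter → M, FreeMonoid.lift φ e.1 = FreeMonoid.lift φ e.2

/-- The variety (class of monoids) given by a system of identities. -/
def var.{w} (S : Set Identity) : Set MonCat.{w} :=
  {M | ∀ e ∈ S, Satisfies M e}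

/-- The identity `e` holds in the class `V` of monoids. -/
def HoldsIn.{w} (V : Set MonCat.{w}) (e : Identity) : Prop :=
  ∀ M ∈ V, Satisfies M e

/-! ### The varieties `K` and `F k` -/

/-- The letters `x₀, x₁, …`. -/
def x (i : ℕ) : Word := FreeMonoid.of (2 * i)

/-- The letters `y₀, y₁, …`, distinct from the `xᵢ`. -/
def y (i : ℕ) : Word := FreeMonoid.of (2 * i + 1)

/-- The system `xyx ≈ xyx²`, `x²y² ≈ y²x²`, `x²y ≈ x²yx`, written with `x = x₀`, `y = y₀`. -/
def Phi : Set Identity :=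
  {(x 0 * y 0 * x 0, x 0 * y 0 * x 0 ^ 2),
   (x 0 ^ 2 * y 0 ^ 2, y 0 ^ 2 * x 0 ^ 2),
   (x 0 ^ 2 * y 0, x 0 ^ 2 * y 0 * x 0)}

/-- `b s = x_{s-1} x_s x_{s-2} x_{s-1} ⋯ x_0 x_1`, and `b 0` is empty. -/
def b : ℕ → Word
  | 0 => 1
  | s + 1 => x s * x (s + 1) * b s

/-- The identity `x_k y_k x_{k-1} x_k y_k b_{k-1} ≈ y_k x_k x_{k-1} x_k y_k b_{k-1}`, for `1 ≤ k`. -/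
def alpha (k : ℕ) : Identity :=
  (x k * y k * x (k - 1) * x k * y k * b (k - 1),
   y k * x k * x (k - 1) * x k * y k * b (k - 1))

/-- The variety `K`. -/
def K.{w} : Set MonCat.{w} := var Phi

/-- The variety `F_k`, for `1 ≤ k`. -/
def F.{w} (k : ℕ) : Set MonCat.{w} := var (Phi ∪ {alpha k})

/-! ### Occurrences, decompositions and restrictors -/

/-- The number of occurrences of the letter `a` in `w`. -/
def occ (a : Letter) (w : Word) : ℕ := w.toList.count a

/-- The content: the set of letters occurring in `w`. -/
def con (w : Word) : Set Letter := {a | 1 ≤ occ a w}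

/-- The set of simple letters of `w`. -/
def sim (w : Word) : Set Letter := {a | occ a w = 1}

/-- The set of multiple letters of `w`. -/
def mul (w : Word) : Set Letter := {a | 2 ≤ occ a w}

/-- A list `[(t₀, w₀), (t₁, w₁), …, (t_m, w_m)]` standing for the factorization
`t₀ w₀ t₁ w₁ ⋯ t_m w_m` of a word into alternating dividers `tᵢ` and blocks `wᵢ`.
The divider `none` is the empty word. -/
abbrev Decomposition : Type := List (Option Letter × List Letter)

/-- `split p t c w` factorizes the word `t · c · w`, where `t` is already known to be a divider and
`c` is the part already read of the block that follows `t`: the new dividers are exactly the letters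
of `w` that satisfy `p`. -/
def split (p : Letter → Bool) : Option Letter → List Letter → List Letter → Decomposition
  | t, c, [] => [(t, c)]
  | t, c, a :: w => if p a then (t, c) :: split p (some a) [] w else split p t (c ++ [a]) w

/-- One refinement step. In every block `c`, the letters that are simple in `c` and do not occur in
the whole word to the left of `c` become dividers. The argument `l` is the part of the whole word
to the left of the listed factors. -/
def refine : List Letter → Decomposition → Decomposition
  | _, [] => []
  | l, (t, c) :: d =>
      split (fun a => c.count a = 1 ∧ a ∉ l ++ t.toList) t [] c ++ refine (l ++ t.toList ++ c) d

/-- The `k`-decomposition of `w`. -/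
def decomposition (w : Word) : ℕ → Decomposition
  | 0 => split (fun a => occ a w = 1) none [] w.toList
  | k + 1 => refine [] (decomposition w k)

/-- The word given by a factorization, letter by letter, each nonempty divider marked by `true`
and each letter inside a block marked by `false`. -/
def marked (d : Decomposition) : List (Letter × Bool) :=
  d.flatMap fun tc => tc.1.toList.map (fun a => (a, true)) ++ tc.2.map (fun a => (a, false))

/-- The part of a marked word strictly to the left of the `i`-th occurrence of the letter `a`
(counted from `1`). -/
def before (a : Letter) : ℕ → List (Letter × Bool) → List (Letter × Bool)
  | _, [] => []
  | i, c :: s =>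
      if c.1 = a then (if i = 1 then [] else c :: before a (i - 1) s) else c :: before a i s

/-- The `(i, k)`-restrictor `h_i^k(w, a)`: the right-most `k`-divider of `w` that precedes the
`i`-th occurrence of `a`; it is `none` if this is the empty divider `t₀`.
Meaningful for `1 ≤ i ≤ occ a w`. -/
def restrictor (i k : ℕ) (w : Word) (a : Letter) : Option Letter :=
  (((before a i (marked (decomposition w k))).filter fun c => c.2).getLast?).map fun c => c.1

/-- `u` and `v` have the same simple letters and the same multiple letters. -/
def SameSimpMul (u v : Word) : Prop := sim u = sim v ∧ mul u = mul v

/-- `h_i^k(u, a) = h_i^k(v, a)` for `i = 1, 2` and all letters `a` of `u`, where the equality for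
`i` is required only if the `i`-th occurrence of `a` exists in both words. -/
def SameRestrictors (k : ℕ) (u v : Word) : Prop :=
  ∀ a ∈ con u, ∀ i : ℕ, (i = 1 ∨ i = 2) → i ≤ occ a u → i ≤ occ a v →
    restrictor i k u a = restrictor i k v a

end MonoidWords

universe w

/-! By Birkhoff's completeness theorem an identity holds in `var S` exactly when it lies in the
fully invariant congruence generated by `S` (`holdsIn_var_iff`), so two descriptions of a word
congruence must be matched.

Every divider is the first occurrence of its letter, so the `n`-decomposition is encoded by the set
of divider letters. A letter becomes a divider at level `n + 1` iff it is simple or a level-`n`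
divider separates its first two occurrences, that is, iff its first two restrictors differ
(`marked_decomposition`).

The bridge is the equivalence generated by `Step n`. Steps preserve the restrictor data
(`eqvGen_step_invariant`). Conversely, words with equal data are linked by steps: delete third and
later occurrences, then sort one word into the other, each letter moving only inside a block
(`eqvGen_step_of_agree`).

Steps of level `n` match the identities of `F (n + 1)`. A swap inside an `n`-block is an instance of
`alpha (n + 1)` once the part of the word after the swap has been rewritten
(`exists_derives_substB`). Conversely, both sides of each defining identity, in any context, are
linked by steps (`consequences_le_stepCon`). For `K`, the divider sets of a word stabilise at some
`n`, and from there swaps follow from `Phi` alone (`Step.derives_of_stable`). -/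

namespace MonoidWords


/-! ### Divider letters, and restrictors read off prefixes -/

open Classical in
/-- Mark every letter of `w` by whether it belongs to `D` and occurs neither in `s` nor earlier
in `w`. -/
noncomputable def annotate (D : Set ℕ) : List ℕ → List ℕ → List (ℕ × Bool)
  | _, [] => []
  | s, a :: w => (a, decide (a ∉ s ∧ a ∈ D)) :: annotate D (s ++ [a]) w

/-- The last marked letter. -/
def lastMark (m : List (ℕ × Bool)) : Option ℕ :=
  ((m.filter fun c => c.2).getLast?).map fun c => c.1

/-- The last letter of `D` in the order of first occurrences in `w`. -/
noncomputable def lastIn (D : Set ℕ) (w : List ℕ) : Option ℕ := lastMark (annotate D [] w)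

/-- The last letter of `D`, in the order of first occurrences, that precedes the `i`-th
occurrence of `a` in `w`. -/
noncomputable def restrict (D : Set ℕ) (i : ℕ) (w : List ℕ) (a : ℕ) : Option ℕ :=
  lastMark (before a i (annotate D [] w))

/-- The letters of `w` that are dividers of its `n`-decomposition. -/
def dividers (w : List ℕ) : ℕ → Set ℕ
  | 0 => {a | w.count a = 1}
  | n + 1 => {a | w.count a = 1 ∨
      2 ≤ w.count a ∧ restrict (dividers w n) 1 w a ≠ restrict (dividers w n) 2 w a}

theorem annotate_append (D : Set ℕ) (s p q : List ℕ) :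
    annotate D s (p ++ q) = annotate D s p ++ annotate D (s ++ p) q := by
  induction p generalizing s with
  | nil => simp [annotate]
  | cons a p ih => simp [annotate, ih]

theorem lastMark_append_singleton (m : List (ℕ × Bool)) (c : ℕ × Bool) :
    lastMark (m ++ [c]) = if c.2 then some c.1 else lastMark m := by
  unfold lastMark
  rw [List.filter_append]
  by_cases h : c.2 = true <;> simp [h]

theorem lastIn_nil (D : Set ℕ) : lastIn D [] = none := rfl

theorem lastIn_concat_of_mem {D : Set ℕ} {p : List ℕ} {a : ℕ} (h : a ∉ p) (hD : a ∈ D) :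
    lastIn D (p ++ [a]) = some a := by
  simp [lastIn, annotate_append, annotate, lastMark_append_singleton, h, hD]

theorem lastIn_concat_of_unmarked {D : Set ℕ} {p : List ℕ} {a : ℕ} (h : a ∈ p ∨ a ∉ D) :
    lastIn D (p ++ [a]) = lastIn D p := by
  have : ¬ (a ∉ p ∧ a ∈ D) := by tauto
  simp only [lastIn, annotate_append, annotate, lastMark_append_singleton, List.nil_append]
  simp only [this, decide_false, Bool.false_eq_true, if_false]

theorem mem_of_lastIn {D : Set ℕ} {p : List ℕ} {c : ℕ} (h : lastIn D p = some c) :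
    c ∈ p ∧ c ∈ D := by
  induction p using List.reverseRecOn with
  | nil => simp [lastIn_nil] at h
  | append_singleton p a ih =>
    by_cases ha : a ∉ p ∧ a ∈ D
    · rw [lastIn_concat_of_mem ha.1 ha.2] at h
      simp only [Option.some.injEq] at h
      subst h
      simp [ha.2]
    · rw [lastIn_concat_of_unmarked (by tauto)] at h
      have := ih h
      simp [this]

theorem exists_lastIn_append {D : Set ℕ} {p r : List ℕ} {b : ℕ} (hb : b ∈ r) (hp : b ∉ p)
    (hD : b ∈ D) : ∃ c, c ∉ p ∧ c ∈ r ∧ lastIn D (p ++ r) = some c := by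
  induction r using List.reverseRecOn with
  | nil => simp at hb
  | append_singleton r a ih =>
    rw [← List.append_assoc]
    by_cases ha : a ∉ p ++ r ∧ a ∈ D
    · refine ⟨a, ?_, by simp, lastIn_concat_of_mem ha.1 ha.2⟩
      have := ha.1
      simp only [List.mem_append, not_or] at this
      exact this.1
    · rw [lastIn_concat_of_unmarked (by tauto)]
      have hbr : b ∈ r := by
        simp only [List.mem_append, List.mem_singleton] at hb ha
        rcases hb with hb | rfl
        · exact hb
        · tauto
      obtain ⟨c, h1, h2, h3⟩ := ih hbr
      exact ⟨c, h1, by simp [h2], h3⟩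

/-- This turns equality of restrictors into the absence of new dividers, so that two positions lie
in the same block. -/
theorem lastIn_append_eq_iff {D : Set ℕ} {p r : List ℕ} :
    lastIn D (p ++ r) = lastIn D p ↔ ∀ b ∈ r, b ∈ p ∨ b ∉ D := by
  constructor
  · intro h b hb
    by_contra hcon
    push Not at hcon
    obtain ⟨c, h1, _, h3⟩ := exists_lastIn_append hb hcon.1 hcon.2
    exact h1 (mem_of_lastIn (h ▸ h3)).1
  · intro h
    induction r using List.reverseRecOn with
    | nil => simp
    | append_singleton r a ih =>
      rw [← List.append_assoc, lastIn_concat_of_unmarked, ih]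
      · exact fun b hb => h b (by simp [hb])
      · rcases h a (by simp) with h | h <;> simp [h]

theorem lastIn_append_congr {D : Set ℕ} {p q : List ℕ} (r : List ℕ) (h : lastIn D p = lastIn D q)
    (hm : ∀ a, a ∈ p ↔ a ∈ q) : lastIn D (p ++ r) = lastIn D (q ++ r) := by
  induction r using List.reverseRecOn with
  | nil => simpa
  | append_singleton r a ih =>
    rw [← List.append_assoc, ← List.append_assoc]
    by_cases ha : a ∉ p ++ r ∧ a ∈ D
    · rw [lastIn_concat_of_mem ha.1 ha.2, lastIn_concat_of_mem _ ha.2]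
      simpa [hm] using ha.1
    · rw [lastIn_concat_of_unmarked (by tauto), lastIn_concat_of_unmarked, ih]
      simp only [List.mem_append, hm] at ha ⊢
      tauto

theorem before_annotate (D : Set ℕ) (a : ℕ) (s p q : List ℕ) :
    before a (p.count a + 1) (annotate D s (p ++ a :: q)) = annotate D s p := by
  induction p generalizing s with
  | nil => simp [annotate, before]
  | cons c p ih =>
    by_cases hc : c = a
    · subst hc
      simp [annotate, before, ih]
    · simp [annotate, before, hc, ih]

theorem restrict_eq {D : Set ℕ} {a i : ℕ} {w p q : List ℕ} (hw : w = p ++ a :: q)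
    (hi : i = p.count a + 1) : restrict D i w a = lastIn D p := by
  subst hw hi
  rw [restrict, before_annotate, lastIn]

theorem exists_prefix {a i : ℕ} {w : List ℕ} (hi : 1 ≤ i) (h : i ≤ w.count a) :
    ∃ p q, w = p ++ a :: q ∧ i = p.count a + 1 := by
  induction w generalizing i with
  | nil => simp at h; omega
  | cons c w ih =>
    by_cases hc : c = a
    · subst hc
      by_cases h1 : i = 1
      · exact ⟨[], w, by simp [h1]⟩
      · simp only [List.count_cons_self] at h
        obtain ⟨p, q, rfl, h2⟩ := ih (i := i - 1) (by omega) (by omega)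
        exact ⟨c :: p, q, by simp, by simp; omega⟩
    · rw [List.count_cons_of_ne hc] at h
      obtain ⟨p, q, rfl, h2⟩ := ih hi h
      exact ⟨c :: p, q, by simp, by rw [List.count_cons_of_ne hc]; exact h2⟩

theorem mem_dividers_zero {w : List ℕ} {a : ℕ} : a ∈ dividers w 0 ↔ w.count a = 1 := Iff.rfl

theorem mem_dividers_succ {w : List ℕ} {a n : ℕ} : a ∈ dividers w (n + 1) ↔ w.count a = 1 ∨
    2 ≤ w.count a ∧ restrict (dividers w n) 1 w a ≠ restrict (dividers w n) 2 w a := Iff.rfl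

/-- The witness may be `a` itself, which is why a divider stays one at all later levels. -/
theorem mem_dividers_succ_of_split {w p q r : List ℕ} {a n : ℕ} (hw : w = p ++ a :: (q ++ a :: r))
    (hp : a ∉ p) (hq : a ∉ q) :
    a ∈ dividers w (n + 1) ↔ ∃ b ∈ a :: q, b ∉ p ∧ b ∈ dividers w n := by
  have hp' : p.count a = 0 := List.count_eq_zero.2 hp
  have hq' : q.count a = 0 := List.count_eq_zero.2 hq
  rw [mem_dividers_succ, restrict_eq (i := 1) hw (by omega),
    restrict_eq (i := 2) (p := p ++ a :: q) (q := r) (by simp [hw]) (by simp [hp', hq'])]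
  have h2 : w.count a = r.count a + 2 := by
    rw [hw]; simp [hp', hq']
  have h3 := lastIn_append_eq_iff (D := dividers w n) (p := p) (r := a :: q)
  rw [eq_comm] at h3
  rw [Ne, h3]
  push Not
  constructor
  · rintro (h | h)
    · omega
    · exact h.2
  · exact fun h => Or.inr ⟨by omega, h⟩

theorem exists_split_of_two_le {w : List ℕ} {a : ℕ} (h : 2 ≤ w.count a) :
    ∃ p q r, w = p ++ a :: (q ++ a :: r) ∧ a ∉ p ∧ a ∉ q := by
  obtain ⟨p, q, rfl, h1⟩ := exists_prefix (i := 1) le_rfl (by omega : 1 ≤ w.count a)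
  have hp : p.count a = 0 := by omega
  simp only [List.count_append, List.count_cons_self] at h
  obtain ⟨q, r, rfl, h2⟩ := exists_prefix (i := 1) le_rfl (by omega : 1 ≤ q.count a)
  exact ⟨p, q, r, rfl, List.count_eq_zero.1 hp, List.count_eq_zero.1 (by omega)⟩

theorem dividers_succ_of_mem {w : List ℕ} {a n : ℕ} (h : a ∈ dividers w n) :
    a ∈ dividers w (n + 1) := by
  by_cases h2 : 2 ≤ w.count a
  · obtain ⟨p, q, r, hw, hp, hq⟩ := exists_split_of_two_le h2
    exact (mem_dividers_succ_of_split hw hp hq).2 ⟨a, by simp, hp, h⟩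
  · rw [mem_dividers_succ]
    cases n with
    | zero => exact Or.inl h
    | succ n => rw [mem_dividers_succ] at h; tauto

theorem dividers_mono (w : List ℕ) : Monotone (dividers w) :=
  monotone_nat_of_le_succ fun _ _ h => dividers_succ_of_mem h

theorem count_pos_of_mem_dividers {w : List ℕ} {a n : ℕ} (h : a ∈ dividers w n) :
    0 < w.count a := by
  cases n with
  | zero => rw [mem_dividers_zero] at h; omega
  | succ n => rw [mem_dividers_succ] at h; omega

/-- The sets increase with `n` inside the finite set of letters of `w`; strict growth at every level
would exceed its size. -/
theorem exists_dividers_stable (w : List ℕ) : ∃ n, dividers w n = dividers w (n + 1) := by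
  by_contra hcon
  push Not at hcon
  have hfin : ∀ n, (dividers w n).Finite := fun n =>
    w.toFinset.finite_toSet.subset fun a ha => by
      simpa using List.count_pos_iff.1 (count_pos_of_mem_dividers ha)
  have hlt : StrictMono fun n => (dividers w n).ncard := strictMono_nat_of_lt_succ fun n =>
    Set.ncard_lt_ncard ((dividers_mono w n.le_succ).ssubset_of_ne (hcon n)) (hfin _)
  have h1 := hlt.le_apply (x := w.toFinset.card + 1)
  have h2 : (dividers w (w.toFinset.card + 1)).ncard ≤ w.toFinset.card := by
    rw [← Set.ncard_coe_finset]
    exact Set.ncard_le_ncard (fun a ha => by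
      simpa using List.count_pos_iff.1 (count_pos_of_mem_dividers ha)) (Finset.finite_toSet _)
  omega


/-! ### Agreement with the block decomposition -/

theorem marked_cons (e : Option ℕ × List ℕ) (d : Decomposition) :
    marked (e :: d) = marked [e] ++ marked d := by
  simp [marked]

theorem marked_append (d e : Decomposition) : marked (d ++ e) = marked d ++ marked e := by
  simp [marked]

theorem marked_split (p : ℕ → Bool) (t : Option ℕ) (c w : List ℕ) :
    marked (split p t c w) = marked [(t, c)] ++ w.map fun a => (a, p a) := by
  induction w generalizing t c with
  | nil => simp [split]
  | cons a w ih =>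
    by_cases h : p a = true
    · rw [split, if_pos h, marked_cons, ih]
      simp [marked, h]
    · rw [split, if_neg h, ih]
      simp only [Bool.not_eq_true] at h
      simp [marked, h]

theorem split_ne_nil (p : ℕ → Bool) (t : Option ℕ) (c w : List ℕ) :
    ∃ c' d, split p t c w = (t, c') :: d ∧ ∀ e ∈ d, e.1 ≠ none := by
  induction w generalizing t c with
  | nil => exact ⟨c, [], rfl, by simp⟩
  | cons a w ih =>
    by_cases h : p a = true
    · obtain ⟨c', d, h1, h2⟩ := ih (some a) []
      refine ⟨c, _, by rw [split, if_pos h], ?_⟩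
      rw [h1]
      intro e he
      rcases List.mem_cons.1 he with rfl | he
      · simp
      · exact h2 e he
    · obtain ⟨c', d, h1, h2⟩ := ih t (c ++ [a])
      exact ⟨c', d, by rw [split, if_neg h, h1], h2⟩

theorem refine_divider_ne_none (l : List ℕ) (d : Decomposition) (hd : ∀ e ∈ d, e.1 ≠ none) :
    ∀ e ∈ refine l d, e.1 ≠ none := by
  induction d generalizing l with
  | nil => simp [refine]
  | cons tc d ih =>
    obtain ⟨t, c⟩ := tc
    intro e he
    rw [refine, List.mem_append] at he
    rcases he with he | he
    · obtain ⟨c', d', h1, h2⟩ := split_ne_nil (fun a => c.count a = 1 ∧ a ∉ l ++ t.toList) t [] c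
      rw [h1] at he
      rcases List.mem_cons.1 he with rfl | he
      · exact hd (t, c) (by simp)
      · exact h2 e he
    · exact ih _ (fun e he => hd e (by simp [he])) e he

theorem decomposition_eq_cons (w : Word) (n : ℕ) :
    ∃ e d, decomposition w n = e :: d ∧ ∀ e ∈ d, e.1 ≠ none := by
  induction n with
  | zero =>
    obtain ⟨c, d, h1, h2⟩ := split_ne_nil (fun a => occ a w = 1) none [] w.toList
    exact ⟨_, d, h1, h2⟩
  | succ n ih =>
    obtain ⟨⟨t, c⟩, d, h1, h2⟩ := ih
    rw [decomposition, h1, refine]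
    obtain ⟨c', d', h3, h4⟩ :=
      split_ne_nil (fun a => c.count a = 1 ∧ a ∉ [] ++ t.toList) t [] c
    rw [h3]
    refine ⟨_, _, List.cons_append, ?_⟩
    intro e he
    rcases List.mem_append.1 he with he | he
    · exact h4 e he
    · exact refine_divider_ne_none _ d h2 e he

theorem annotate_eq_map {D : Set ℕ} {f : ℕ → Bool} {s c : List ℕ}
    (h : ∀ c₁ a c₂, c = c₁ ++ a :: c₂ → (f a = true ↔ a ∉ s ++ c₁ ∧ a ∈ D)) :
    annotate D s c = c.map fun a => (a, f a) := by
  induction c generalizing s with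
  | nil => simp [annotate]
  | cons a c ih =>
    rw [annotate, ih]
    · have := h [] a c rfl
      simp only [List.append_nil] at this
      rw [List.map_cons]
      congr 2
      rw [Bool.eq_iff_iff, this]
      simp only [decide_eq_true_eq]
    · intro c₁ b c₂ hc
      have := h (a :: c₁) b c₂ (by simp [hc])
      simpa using this

theorem unmarked_of_annotate_eq_map_false {D : Set ℕ} {s c : List ℕ}
    (h : annotate D s c = c.map fun a => (a, false)) : ∀ a ∈ c, a ∈ s ∨ a ∉ D := by
  induction c generalizing s with
  | nil => simp
  | cons a c ih =>
    rw [annotate, List.map_cons, List.cons.injEq] at h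
    have h1 : a ∈ s ∨ a ∉ D := by
      have := (Prod.mk.inj h.1).2
      simp only [decide_eq_false_iff_not] at this
      tauto
    intro b hb
    rcases List.mem_cons.1 hb with rfl | hb
    · exact h1
    · rcases ih h.2 b hb with h3 | h3
      · rcases List.mem_append.1 h3 with h3 | h3
        · exact Or.inl h3
        · rw [List.mem_singleton] at h3
          exact h3 ▸ h1
      · exact Or.inr h3

theorem map_fst_annotate (D : Set ℕ) (s w : List ℕ) : (annotate D s w).map Prod.fst = w := by
  induction w generalizing s with
  | nil => rfl
  | cons a w ih => simp [annotate, ih]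

theorem annotate_append_eq {D : Set ℕ} {s w : List ℕ} {m₁ m₂ : List (ℕ × Bool)}
    (h : annotate D s w = m₁ ++ m₂) :
    w = m₁.map Prod.fst ++ m₂.map Prod.fst ∧ annotate D s (m₁.map Prod.fst) = m₁ ∧
      annotate D (s ++ m₁.map Prod.fst) (m₂.map Prod.fst) = m₂ := by
  have hw : w = m₁.map Prod.fst ++ m₂.map Prod.fst := by
    rw [← List.map_append, ← h, map_fst_annotate]
  refine ⟨hw, ?_⟩
  rw [hw, annotate_append] at h
  refine List.append_inj h ?_
  have := congrArg List.length (map_fst_annotate D s (m₁.map Prod.fst))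
  simpa using this

/-- Being simple in a block means that the next occurrence, if any, lies beyond the divider that
closes the block. Such a divider must really be a letter, so only the head factor may carry the
empty divider. -/
theorem marked_refine {w l r : List ℕ} {n : ℕ} {d : Decomposition} (hw : w = l ++ r)
    (hm : marked d = annotate (dividers w n) l r) (hd : ∀ e ∈ d.tail, e.1 ≠ none) :
    marked (refine l d) = annotate (dividers w (n + 1)) l r := by
  induction d generalizing l r with
  | nil =>
    have := map_fst_annotate (dividers w n) l r
    rw [← hm] at this
    simp only [marked, List.flatMap_nil, List.map_nil] at this
    subst this
    simp [refine, marked, annotate]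
  | cons tc d ih =>
    obtain ⟨t, c⟩ := tc
    rw [List.tail_cons] at hd
    rw [refine, marked_append, marked_split]
    have hm' := hm.symm
    rw [marked_cons, show marked [(t, c)] = t.toList.map (fun a => (a, true)) ++
      c.map (fun a => (a, false)) by simp [marked], List.append_assoc] at hm'
    obtain ⟨hr, ht, hm2⟩ := annotate_append_eq hm'
    obtain ⟨hr2, hc, hd2⟩ := annotate_append_eq hm2
    simp only [List.map_map, Function.comp_def, List.map_id'] at hr ht hr2 hc hd2
    rw [hr2] at hr
    clear hr2 hm2 hm'
    set r' := (marked d).map Prod.fst with hr'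
    have hunm := unmarked_of_annotate_eq_map_false hc
    rw [ih (l := l ++ t.toList ++ c) (r := r') (by simp [hw, hr]) hd2.symm
      (fun e he => hd e (List.mem_of_mem_tail he))]
    rw [hr, annotate_append, annotate_append, ← List.append_assoc]
    congr 2
    · rw [annotate_eq_map (f := fun _ => true)]
      · simp [marked]
      · intro c₁ a c₂ h
        cases t with
        | none => simp at h
        | some b =>
          simp only [Option.toList_some] at h
          have hc1 : c₁ = [] := by
            rcases c₁ with _ | ⟨_, c₁⟩
            · rfl
            · simp at h
          subst hc1
          simp only [List.nil_append, List.cons.injEq] at h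
          obtain ⟨rfl, rfl⟩ := h
          simp only [Option.toList_some, annotate, List.map_cons, List.map_nil, List.cons.injEq,
            Prod.mk.injEq, decide_eq_true_iff, and_true, true_and] at ht
          simpa using ⟨ht.1, dividers_succ_of_mem ht.2⟩
    · symm
      apply annotate_eq_map
      intro c₁ a c₂ hc12
      simp only [decide_eq_true_iff]
      constructor
      · rintro ⟨h1, h2⟩
        rw [hc12] at h1
        simp only [List.count_append, List.count_cons_self] at h1
        have hc1 : a ∉ c₁ := List.count_eq_zero.1 (by omega)
        have hc2 : a ∉ c₂ := List.count_eq_zero.1 (by omega)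
        have hp : a ∉ l ++ t.toList ++ c₁ := by
          rw [List.mem_append]; tauto
        refine ⟨hp, ?_⟩
        -- If `a` recurs after the block, the divider `b` of the next factor lies between the two
        -- occurrences and is the required witness; otherwise `a` is simple in `w`.
        by_cases har : a ∈ r'
        · obtain ⟨q, s, hqs, hq0⟩ := exists_prefix (i := 1) le_rfl (List.count_pos_iff.2 har)
          have hq : a ∉ q := List.count_eq_zero.1 (by omega)
          have hmain := (mem_dividers_succ_of_split (w := w) (p := l ++ t.toList ++ c₁)
            (q := c₂ ++ q) (r := s) (a := a) (n := n) (by simp [hw, hr, hc12, hqs]) hp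
            (by simp [hc2, hq])).2
          apply hmain
          rcases d with _ | ⟨⟨t', c'⟩, d⟩
          · simp [hr', marked] at har
          · cases t' with
            | none => exact absurd rfl (hd (none, c') (by simp))
            | some b =>
              have hrb : ∃ r'', r' = b :: r'' ∧ marked ((some b, c') :: d) =
                  (b, true) :: (marked [(none, c')] ++ marked d) := by
                refine ⟨_, by rw [hr']; simp [marked]; rfl, by simp [marked]⟩
              obtain ⟨r'', hr'', hmk⟩ := hrb
              rw [hr'', hmk] at hd2
              simp only [annotate, List.cons.injEq, Prod.mk.injEq, decide_eq_true_iff,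
                true_and] at hd2
              obtain ⟨⟨hb1, hb2⟩, -⟩ := hd2
              rw [hc12] at hb1
              have hbq : b ∈ q := by
                rcases q with _ | ⟨b', q⟩
                · rw [hr''] at hqs
                  simp only [List.nil_append, List.cons.injEq] at hqs
                  exact absurd (by simp [hqs.1]) hb1
                · rw [hr''] at hqs
                  simp only [List.cons_append, List.cons.injEq] at hqs
                  simp [hqs.1]
              refine ⟨b, by simp [hbq], ?_, hb2⟩
              intro hb
              exact hb1 (by
                simp only [List.mem_append, List.mem_cons] at hb ⊢
                tauto)
        · rw [mem_dividers_succ]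
          left
          rw [hw, hr, hc12]
          have e1 := List.count_eq_zero.2 hp
          have e2 := List.count_eq_zero.2 hc2
          have e3 := List.count_eq_zero.2 har
          simp only [List.count_append] at e1
          simp only [List.count_append, List.count_cons_self]
          omega
      · rintro ⟨hp, hD⟩
        have hlt : a ∉ l ++ t.toList := fun h => hp (List.mem_append_left _ h)
        have hc1 : a ∉ c₁ := fun h => hp (List.mem_append_right _ h)
        refine ⟨?_, hlt⟩
        rw [hc12]
        -- A second occurrence in the same block would need a new level-`n` divider inside it,
        -- against `hunm`.
        by_cases hc2 : a ∈ c₂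
        · exfalso
          obtain ⟨q, s, hqs, hq⟩ := exists_prefix (i := 1) le_rfl (List.count_pos_iff.2 hc2)
          have hq' : a ∉ q := List.count_eq_zero.1 (by omega)
          obtain ⟨b, hb, hb1, hb2⟩ := (mem_dividers_succ_of_split (w := w)
            (p := l ++ t.toList ++ c₁) (q := q) (r := s ++ r') (a := a) (n := n)
            (by simp [hw, hr, hc12, hqs]) hp hq').1 hD
          rcases hunm b (by rw [hc12, hqs]; simp at hb ⊢; tauto) with h | h
          · exact hb1 (List.mem_append_left _ h)
          · exact h hb2
        · rw [List.count_append, List.count_cons_self, List.count_eq_zero.2 hc1,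
            List.count_eq_zero.2 hc2]

theorem marked_decomposition (w : Word) (n : ℕ) :
    marked (decomposition w n) = annotate (dividers w.toList n) [] w.toList := by
  induction n with
  | zero =>
    rw [decomposition, marked_split, annotate_eq_map (f := fun a => decide (occ a w = 1))]
    · simp [marked]
    · intro c₁ a c₂ h
      simp only [decide_eq_true_iff, mem_dividers_zero, List.nil_append]
      refine ⟨fun h1 => ⟨?_, h1⟩, fun h1 => h1.2⟩
      intro h2
      have := List.count_pos_iff.2 h2
      rw [occ, h, List.count_append, List.count_cons_self] at h1
      omega
  | succ n ih =>
    obtain ⟨e, d, h1, h2⟩ := decomposition_eq_cons w n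
    exact marked_refine (by simp) ih (by rw [h1]; exact h2)

theorem restrictor_eq_restrict (i n : ℕ) (w : Word) (a : ℕ) :
    restrictor i n w a = restrict (dividers w.toList n) i w.toList a := by
  rw [restrictor, marked_decomposition]
  rfl


/-! ### Elementary steps and their invariants -/

/-- Inserting a letter to the right of its second occurrence, or exchanging two adjacent letters
inside a block of the `n`-decomposition. -/
inductive Step (n : ℕ) : List ℕ → List ℕ → Prop
  | insert (p q : List ℕ) (a : ℕ) (h : 2 ≤ p.count a) : Step n (p ++ q) (p ++ a :: q)
  | swap (p q : List ℕ) (a b : ℕ) (ha : a ∈ p ∨ a ∉ dividers (p ++ a :: b :: q) n)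
      (hb : b ∈ p ∨ b ∉ dividers (p ++ a :: b :: q) n) :
      Step n (p ++ a :: b :: q) (p ++ b :: a :: q)

/-- `u` and `v` have the same simple letters, the same multiple letters, and the same restrictors
of first and second occurrences with respect to the sets of dividers `D` and `E`. -/
def Agree (D E : Set ℕ) (u v : List ℕ) : Prop :=
  ∀ a, min 2 (u.count a) = min 2 (v.count a) ∧
    ∀ i, (i = 1 ∨ i = 2) → i ≤ u.count a → restrict D i u a = restrict E i v a

theorem Agree.symm {D E : Set ℕ} {u v : List ℕ} (h : Agree D E u v) : Agree E D v u :=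
  fun a => ⟨(h a).1.symm, fun i hi hle => ((h a).2 i hi (by have := (h a).1; omega)).symm⟩

theorem Agree.trans {D E F : Set ℕ} {u v w : List ℕ} (h : Agree D E u v) (h' : Agree E F v w) :
    Agree D F u w :=
  fun a => ⟨(h a).1.trans (h' a).1, fun i hi hle =>
    ((h a).2 i hi hle).trans ((h' a).2 i hi (by have := (h a).1; omega))⟩

theorem Agree.dividers_zero {D E : Set ℕ} {u v : List ℕ} (h : Agree D E u v) :
    dividers u 0 = dividers v 0 := by
  ext a
  have := (h a).1
  rw [mem_dividers_zero, mem_dividers_zero]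
  omega

theorem Agree.dividers_succ {u v : List ℕ} {n : ℕ}
    (h : Agree (dividers u n) (dividers v n) u v) :
    dividers u (n + 1) = dividers v (n + 1) := by
  ext a
  have h0 := (h a).1
  rw [mem_dividers_succ, mem_dividers_succ]
  by_cases h2 : 2 ≤ u.count a
  · rw [(h a).2 1 (by simp) (by omega), (h a).2 2 (by simp) h2]
    have h3 : 2 ≤ v.count a := by omega
    have h4 : u.count a ≠ 1 := by omega
    have h5 : v.count a ≠ 1 := by omega
    simp [h2, h3, h4, h5]
  · have h3 : ¬ 2 ≤ v.count a := by omega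
    have h4 : u.count a = v.count a := by omega
    simp [h4, h3]

theorem agree_of_prefix {D : Set ℕ} {u v : List ℕ}
    (hc : ∀ a, min 2 (u.count a) = min 2 (v.count a))
    (h : ∀ p a q, u = p ++ a :: q → p.count a ≤ 1 →
      ∃ p' q', v = p' ++ a :: q' ∧ p'.count a = p.count a ∧ lastIn D p' = lastIn D p) :
    Agree D D u v := by
  refine fun a => ⟨hc a, fun i hi hle => ?_⟩
  obtain ⟨p, q, hu, hp⟩ := exists_prefix (by omega) hle
  obtain ⟨p', q', hv, hcount, hlast⟩ := h p a q hu (by omega)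
  rw [restrict_eq hu hp, restrict_eq hv (by omega), hlast]

theorem agree_insert (D : Set ℕ) {p q : List ℕ} {a : ℕ} (ha : 2 ≤ p.count a) :
    Agree D D (p ++ q) (p ++ a :: q) := by
  have hap : a ∈ p := List.count_pos_iff.1 (by omega)
  refine agree_of_prefix (fun b => ?_) fun r c s hu hcount => ?_
  · by_cases hb : b = a
    · subst hb
      simp only [List.count_append, List.count_cons_self]
      omega
    · simp [List.count_cons_of_ne (Ne.symm hb)]
  · rcases List.append_eq_append_iff.1 hu with ⟨t, rfl, ht⟩ | ⟨t, rfl, ht⟩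
    · refine ⟨p ++ a :: t, s, by simp [ht], ?_, ?_⟩
      · by_cases hc : c = a
        · subst hc
          rw [List.count_append] at hcount
          omega
        · simp [List.count_cons_of_ne (Ne.symm hc)]
      · rw [show p ++ a :: t = (p ++ [a]) ++ t by simp]
        apply lastIn_append_congr
        · exact lastIn_concat_of_unmarked (Or.inl hap)
        · intro b
          simp only [List.mem_append, List.mem_singleton]
          constructor
          · rintro (h | rfl) <;> assumption
          · exact Or.inl
    · rcases t with _ | ⟨d, t⟩
      · simp only [List.nil_append] at ht
        subst ht
        simp only [List.append_nil] at ha hap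
        refine ⟨r ++ [a], s, by simp, ?_, lastIn_concat_of_unmarked (Or.inl hap)⟩
        rw [List.count_append, List.count_singleton]
        split
        · simp_all
          omega
        · rfl
      · simp only [List.cons_append, List.cons.injEq] at ht
        obtain ⟨rfl, rfl⟩ := ht
        exact ⟨r, t ++ a :: q, by simp, rfl, rfl⟩

theorem agree_swap {D : Set ℕ} {p q : List ℕ} {a b : ℕ} (ha : a ∈ p ∨ a ∉ D)
    (hb : b ∈ p ∨ b ∉ D) : Agree D D (p ++ a :: b :: q) (p ++ b :: a :: q) := by
  by_cases hab : a = b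
  · subst hab
    exact agree_of_prefix (fun _ => rfl) fun r c s hu _ => ⟨r, s, hu, rfl, rfl⟩
  refine agree_of_prefix (fun c => ?_) fun r c s hu _ => ?_
  · have : (p ++ a :: b :: q).count c = (p ++ b :: a :: q).count c :=
      ((List.Perm.swap b a q).append_left p).count_eq c
    rw [this]
  · rcases List.append_eq_append_iff.1 hu with ⟨t, rfl, ht⟩ | ⟨t, rfl, ht⟩
    · rcases t with _ | ⟨d, t⟩
      · simp only [List.nil_append, List.cons.injEq] at ht
        obtain ⟨rfl, rfl⟩ := ht
        refine ⟨p ++ [b], q, by simp, ?_, ?_⟩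
        · simp [List.count_cons_of_ne (Ne.symm hab)]
        · rw [lastIn_concat_of_unmarked hb, List.append_nil]
      · simp only [List.cons_append, List.cons.injEq] at ht
        obtain ⟨rfl, ht⟩ := ht
        rcases t with _ | ⟨d, t⟩
        · simp only [List.nil_append, List.cons.injEq] at ht
          obtain ⟨rfl, rfl⟩ := ht
          refine ⟨p, a :: q, by simp, ?_, (lastIn_concat_of_unmarked ha).symm⟩
          simp [List.count_cons_of_ne hab]
        · simp only [List.cons_append, List.cons.injEq] at ht
          obtain ⟨rfl, rfl⟩ := ht
          refine ⟨p ++ b :: a :: t, s, by simp,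
            ((List.Perm.swap a b t).append_left p).count_eq c, ?_⟩
          rw [show p ++ b :: a :: t = (p ++ [b, a]) ++ t by simp,
            show p ++ a :: b :: t = (p ++ [a, b]) ++ t by simp]
          apply lastIn_append_congr
          · rw [lastIn_append_eq_iff.2, lastIn_append_eq_iff.2] <;> simp <;> tauto
          · intro x
            simp
            tauto
    · rcases t with _ | ⟨d, t⟩
      · simp only [List.nil_append, List.cons.injEq] at ht
        obtain ⟨rfl, rfl⟩ := ht
        refine ⟨r ++ [b], q, by simp, ?_, ?_⟩
        · simp [List.count_cons_of_ne (Ne.symm hab)]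
        · rw [lastIn_concat_of_unmarked (by simpa using hb)]
      · simp only [List.cons_append, List.cons.injEq] at ht
        obtain ⟨rfl, rfl⟩ := ht
        exact ⟨r, t ++ b :: a :: q, by simp, rfl, rfl⟩

theorem Step.agree {n j : ℕ} {u v : List ℕ} (h : Step n u v) (hj : j ≤ n) :
    Agree (dividers u j) (dividers u j) u v := by
  rcases h with ⟨p, q, a, ha⟩ | ⟨p, q, a, b, ha, hb⟩
  · exact agree_insert _ ha
  · exact agree_swap (ha.imp_right fun h h' => h (dividers_mono _ hj h'))
      (hb.imp_right fun h h' => h (dividers_mono _ hj h'))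

/-- Level-`j` restrictors determine the dividers of level `j + 1`, so preserving restrictors up to
level `n` preserves dividers up to `n + 1`. -/
theorem Step.dividers_eq {n j : ℕ} {u v : List ℕ} (h : Step n u v) (hj : j ≤ n + 1) :
    dividers u j = dividers v j := by
  induction j with
  | zero => exact (h.agree n.zero_le).dividers_zero
  | succ j ih =>
    have h1 := h.agree (j := j) (by omega)
    have h2 := ih (by omega)
    refine Agree.dividers_succ ?_
    rw [← h2]
    exact h1

theorem eqvGen_step_invariant {n : ℕ} {u v : List ℕ} (h : Relation.EqvGen (Step n) u v) :
    (∀ j ≤ n + 1, dividers u j = dividers v j) ∧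
      Agree (dividers u n) (dividers v n) u v := by
  induction h with
  | rel u v h =>
    refine ⟨fun j => h.dividers_eq, ?_⟩
    rw [← h.dividers_eq (by omega)]
    exact h.agree le_rfl
  | refl u => exact ⟨fun _ _ => rfl, fun _ => ⟨rfl, fun _ _ _ => rfl⟩⟩
  | symm u v _ ih => exact ⟨fun j hj => (ih.1 j hj).symm, ih.2.symm⟩
  | trans u v w _ _ ih ih' =>
    exact ⟨fun j hj => (ih.1 j hj).trans (ih'.1 j hj), ih.2.trans ih'.2⟩

/-- A permutation is a product of adjacent transpositions, and the divider set does not change along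
the way, so the side condition survives. -/
theorem eqvGen_step_perm {n : ℕ} {z z' : List ℕ} (hz : z.Perm z') (p q : List ℕ)
    (h : ∀ a ∈ z, a ∈ p ∨ a ∉ dividers (p ++ z ++ q) n) :
    Relation.EqvGen (Step n) (p ++ z ++ q) (p ++ z' ++ q) := by
  induction hz generalizing p with
  | nil => exact .refl _
  | cons a _ ih =>
    have := ih (p ++ [a]) fun b hb => by
      have := h b (by simp [hb])
      simp only [List.append_assoc, List.mem_append, List.cons_append, List.nil_append] at this ⊢
      tauto
    simpa using this
  | swap a b l =>
    have := Step.swap (n := n) p (l ++ q) b a (by simpa using h b (by simp))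
      (by simpa using h a (by simp))
    simpa using Relation.EqvGen.rel _ _ this
  | trans h1 _ ih ih' =>
    have h2 := ih p h
    refine .trans _ _ _ h2 (ih' p fun a ha => ?_)
    rw [← (eqvGen_step_invariant h2).1 n (by omega)]
    exact h a (h1.mem_iff.2 ha)

/-! ### Restrictors of one level determine those of lower levels -/

theorem lastIn_eq_of_lastIn_not_mem {D E : Set ℕ} (hDE : D ⊆ E) {a b : List ℕ} {s : ℕ}
    (ha : s ∉ a) (h : lastIn E (a ++ s :: b) = some s) (hs : s ∉ D) :
    lastIn D (a ++ s :: b) = lastIn D a := by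
  rw [lastIn_append_eq_iff]
  intro c hc
  rcases List.mem_cons.1 hc with rfl | hc
  · exact Or.inr hs
  · have h1 := lastIn_concat_of_mem ha (mem_of_lastIn h).2
    rw [← h1, show a ++ s :: b = (a ++ [s]) ++ b by simp, lastIn_append_eq_iff] at h
    rcases h c hc with h | h
    · simp only [List.mem_append, List.mem_singleton] at h
      rcases h with h | rfl
      · exact Or.inl h
      · exact Or.inr hs
    · exact Or.inr fun h' => h (hDE h')

theorem lastIn_eq_of_lastIn_mem {D E : Set ℕ} (hDE : D ⊆ E) {a : List ℕ} {s : ℕ}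
    (h : lastIn E a = some s) (hs : s ∈ D) : lastIn D a = some s := by
  obtain ⟨p, q, rfl, hp⟩ := exists_prefix (i := 1) le_rfl
    (List.count_pos_iff.2 (mem_of_lastIn h).1)
  have hp' : s ∉ p := List.count_eq_zero.1 (by omega)
  rw [← lastIn_concat_of_mem hp' hs, show p ++ s :: q = (p ++ [s]) ++ q by simp,
    lastIn_append_eq_iff]
  rw [← lastIn_concat_of_mem hp' (hDE hs), show p ++ s :: q = (p ++ [s]) ++ q by simp,
    lastIn_append_eq_iff] at h
  exact fun c hc => (h c hc).imp_right fun h' h'' => h' (hDE h'')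

theorem lastIn_eq_none_of_subset {D E : Set ℕ} (hDE : D ⊆ E) {a : List ℕ}
    (h : lastIn E a = none) : lastIn D a = none := by
  have h1 := lastIn_append_eq_iff (D := E) (p := []) (r := a)
  rw [lastIn_nil, List.nil_append] at h1
  have h2 := lastIn_append_eq_iff (D := D) (p := []) (r := a)
  rw [lastIn_nil, List.nil_append] at h2
  exact h2.2 fun c hc => (h1.1 h c hc).imp_right fun h' h'' => h' (hDE h'')

/-- Let `s` be the restrictor of a prefix for the larger sets. If `s ∈ D` it is also the restrictor
for `D`; otherwise the restrictor for `D` is that of the first occurrence of `s`, a shorter prefix.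
Strong induction on the prefix length closes the argument. -/
theorem Agree.of_subset {D E F : Set ℕ} {u v : List ℕ} (h : Agree E F u v) (hE : D ⊆ E)
    (hF : D ⊆ F) : Agree D D u v := by
  have key : ∀ m, ∀ (p p' : List ℕ) (a : ℕ) (q q' : List ℕ), p.length = m → u = p ++ a :: q →
      v = p' ++ a :: q' → p.count a = p'.count a → p.count a ≤ 1 →
      lastIn D p = lastIn D p' := by
    intro m
    induction m using Nat.strong_induction_on with
    | _ m ih =>
      intro p p' a q q' hm hu hv hc hc1
      have h1 := (h a).2 (p.count a + 1) (by omega) (by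
        rw [hu, List.count_append, List.count_cons_self]; omega)
      rw [restrict_eq hu rfl, restrict_eq hv (by omega)] at h1
      cases hs : lastIn E p with
      | none =>
        rw [lastIn_eq_none_of_subset hE hs, lastIn_eq_none_of_subset hF (h1 ▸ hs)]
      | some s =>
        have hs' : lastIn F p' = some s := h1 ▸ hs
        by_cases hsD : s ∈ D
        · rw [lastIn_eq_of_lastIn_mem hE hs hsD, lastIn_eq_of_lastIn_mem hF hs' hsD]
        · obtain ⟨r, t, rfl, hr⟩ := exists_prefix (i := 1) le_rfl
            (List.count_pos_iff.2 (mem_of_lastIn hs).1)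
          obtain ⟨r', t', rfl, hr'⟩ := exists_prefix (i := 1) le_rfl
            (List.count_pos_iff.2 (mem_of_lastIn hs').1)
          rw [lastIn_eq_of_lastIn_not_mem hE (List.count_eq_zero.1 (by omega)) hs hsD,
            lastIn_eq_of_lastIn_not_mem hF (List.count_eq_zero.1 (by omega)) hs' hsD]
          refine ih r.length ?_ r r' s (t ++ a :: q) (t' ++ a :: q') rfl (by simp [hu])
            (by simp [hv]) (by omega) (by omega)
          rw [← hm]
          simp
  refine fun a => ⟨(h a).1, fun i hi hle => ?_⟩
  have h0 := (h a).1
  obtain ⟨p, q, hu, hp⟩ := exists_prefix (by omega) hle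
  obtain ⟨p', q', hv, hp'⟩ := exists_prefix (a := a) (w := v) (i := i) (by omega) (by omega)
  rw [restrict_eq hu hp, restrict_eq hv hp']
  exact key _ p p' a q q' rfl hu hv (by omega) (by omega)

theorem Agree.dividers_eq {n j : ℕ} {u v : List ℕ}
    (h : Agree (dividers u n) (dividers v n) u v) (hj : j ≤ n + 1) :
    dividers u j = dividers v j := by
  induction j with
  | zero => exact h.dividers_zero
  | succ j ih =>
    have h2 := ih (by omega)
    refine Agree.dividers_succ ?_
    rw [← h2]
    exact h.of_subset (dividers_mono u (by omega)) (h2 ▸ dividers_mono v (by omega))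

/-! ### From equal restrictors to a chain of steps -/

theorem exists_eqvGen_count_le_two (n : ℕ) (u : List ℕ) :
    ∃ u', Relation.EqvGen (Step n) u u' ∧ ∀ a, u'.count a ≤ 2 := by
  induction hl : u.length using Nat.strong_induction_on generalizing u with
  | _ l ih =>
    by_cases h : ∀ a, u.count a ≤ 2
    · exact ⟨u, .refl _, h⟩
    · push Not at h
      obtain ⟨a, ha⟩ := h
      obtain ⟨p, q, rfl, hp⟩ := exists_prefix (i := 3) (by omega) ha
      obtain ⟨u', h1, h2⟩ := ih (p ++ q).length (by rw [← hl]; simp) (p ++ q) rfl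
      exact ⟨u', .trans _ _ _ (.symm _ _ (.rel _ _ (.insert p q a (by omega)))) h1, h2⟩

/-- With `p` already matched, the next letter `b` of the target is brought to the front of `u = g b
q` across `g`. The bound on counts ensures that every occurrence is a first or second one, hence
controlled by `Agree`. -/
theorem eqvGen_step_of_perm {n : ℕ} (v p u : List ℕ) (hperm : u.Perm v)
    (hcount : ∀ a, (p ++ u).count a ≤ 2)
    (h : Agree (dividers (p ++ u) n) (dividers (p ++ v) n) (p ++ u) (p ++ v)) :
    Relation.EqvGen (Step n) (p ++ u) (p ++ v) := by
  induction v generalizing p u with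
  | nil =>
    rw [List.perm_nil.1 hperm]
    exact .refl _
  | cons b v ih =>
    have hD := h.dividers_eq (j := n) (by omega)
    obtain ⟨g, q, hu, hg⟩ := exists_prefix (i := 1) (a := b) (w := u) le_rfl
      (List.count_pos_iff.2 (hperm.mem_iff.2 (by simp)))
    subst hu
    have hbg : g.count b = 0 := by omega
    have hcb := hcount b
    simp only [List.count_append, List.count_cons_self] at hcb
    have h1 := (h b).2 (p.count b + 1) (by omega) (by
      simp only [List.count_append, List.count_cons_self]; omega)
    rw [restrict_eq (p := p ++ g) (q := q) (by simp) (by simp [hbg]),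
      restrict_eq (p := p) (q := v) rfl rfl, ← hD, lastIn_append_eq_iff] at h1
    -- Comparing the restrictors of `b` shows that `g` has no new divider. For `b` itself, compare
    -- those of the first letter of `g`, which stands after `b` in the target. If `g` is empty, `b`
    -- may be a divider, but nothing has to move.
    have hunm : ∀ c ∈ g ++ [b], g ≠ [] → c ∈ p ∨ c ∉ dividers (p ++ (g ++ b :: q)) n := by
      intro c hc hne
      rcases List.mem_append.1 hc with hc | hc
      · exact h1 c hc
      · rw [List.mem_singleton] at hc
        subst hc
        obtain ⟨a, g, rfl⟩ := List.exists_cons_of_ne_nil hne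
        have hac : a ≠ c := by
          rintro rfl
          simp at hbg
        have hav : a ∈ v := by
          have := hperm.mem_iff.1 (show a ∈ a :: g ++ c :: q by simp)
          simpa [hac] using this
        obtain ⟨s, t, rfl, hs⟩ := exists_prefix (i := 1) le_rfl (List.count_pos_iff.2 hav)
        have hca := hcount a
        simp only [List.count_append, List.cons_append, List.count_cons_self] at hca
        have h2 := (h a).2 (p.count a + 1) (by omega) (by
          simp only [List.count_append, List.cons_append, List.count_cons_self]; omega)
        rw [restrict_eq (p := p) (q := g ++ c :: q) (by simp) rfl,
          restrict_eq (p := p ++ c :: s) (q := t) (by simp)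
            (by rw [List.count_append, List.count_cons_of_ne hac.symm]; omega), ← hD, eq_comm,
          lastIn_append_eq_iff] at h2
        exact h2 c (by simp)
    have hmove : Relation.EqvGen (Step n) (p ++ (g ++ b :: q)) ((p ++ [b]) ++ (g ++ q)) := by
      by_cases hne : g = []
      · subst hne
        simpa using Relation.EqvGen.refl _
      · have := eqvGen_step_perm (n := n) (List.perm_append_comm (l₁ := g) (l₂ := [b])) p q
          fun a ha => by simpa using hunm a ha hne
        simpa using this
    have hperm' : (g ++ q).Perm v :=
      (List.Perm.cons_inv ((List.perm_middle (a := b) (l₁ := g) (l₂ := q)).symm.trans hperm))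
    have h3 := ih (p ++ [b]) (g ++ q) hperm'
      (fun a => by
        have := hcount a
        simp only [List.count_append, List.count_cons, List.count_nil] at this ⊢
        omega)
      (by
        have := (eqvGen_step_invariant hmove).2.symm.trans h
        simpa using this)
    exact hmove.trans _ _ _ (by simpa using h3)

theorem eqvGen_step_of_agree {n : ℕ} {u v : List ℕ}
    (h : Agree (dividers u n) (dividers v n) u v) : Relation.EqvGen (Step n) u v := by
  obtain ⟨u', hu, hu2⟩ := exists_eqvGen_count_le_two n u
  obtain ⟨v', hv, hv2⟩ := exists_eqvGen_count_le_two n v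
  have h' := ((eqvGen_step_invariant hu).2.symm.trans h).trans (eqvGen_step_invariant hv).2
  refine hu.trans _ _ _ (.trans _ _ _ ?_ (hv.symm))
  have hperm : u'.Perm v' := List.perm_iff_count.2 fun a => by
    have := (h' a).1
    have := hu2 a
    have := hv2 a
    omega
  exact eqvGen_step_of_perm v' [] u' hperm hu2 h'


/-! ### Equational logic -/

/-- The fully invariant congruence on words generated by the identities in `S`. -/
def consequences (S : Set Identity) : Con Word :=
  conGen fun p q => ∃ e ∈ S, ∃ φ : Letter → Word,
    p = FreeMonoid.lift φ e.1 ∧ q = FreeMonoid.lift φ e.2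

theorem holdsIn_var_of_consequences {S : Set Identity} {u v : Word} (h : consequences S u v) :
    HoldsIn.{w} (var.{w} S) (u, v) := by
  intro M hM φ
  suffices consequences S ≤ Con.ker (FreeMonoid.lift φ) from this h
  refine Con.conGen_le.2 ?_
  rintro p q ⟨e, he, ψ, rfl, rfl⟩
  rw [Con.ker_rel]
  have h1 : ∀ t : Word, FreeMonoid.lift φ (FreeMonoid.lift ψ t) =
      FreeMonoid.lift (fun a => FreeMonoid.lift φ (ψ a)) t := fun t =>
    DFunLike.congr_fun (FreeMonoid.hom_eq fun a => by simp :
      (FreeMonoid.lift φ).comp (FreeMonoid.lift ψ) =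
        FreeMonoid.lift fun a => FreeMonoid.lift φ (ψ a)) t
  rw [h1, h1]
  exact hM e he _

/-- The quotient of the free monoid by the congruence belongs to the variety; evaluating there at
the generators gives the claim. `ULift` moves this monoid to the required universe. -/
theorem consequences_of_holdsIn_var {S : Set Identity} {u v : Word}
    (h : HoldsIn.{w} (var.{w} S) (u, v)) : consequences S u v := by
  let Q := (consequences S).Quotient
  have hlift : ∀ (φ : Letter → ULift.{w} Q) (ψ : Letter → Word),
      (∀ a, φ a = ULift.up (ψ a : Q)) → ∀ t : Word,
      FreeMonoid.lift φ t = ULift.up ((FreeMonoid.lift ψ t : Word) : Q) := by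
    intro φ ψ hφ t
    have : FreeMonoid.lift φ = ((MulEquiv.ulift.{0, w} (α := Q)).symm.toMonoidHom.comp
        (consequences S).mk').comp (FreeMonoid.lift ψ) :=
      FreeMonoid.hom_eq fun a => by rw [FreeMonoid.lift_eval_of, hφ a]; rfl
    rw [this]
    rfl
  have hM : MonCat.of (ULift.{w} Q) ∈ var.{w} S := by
    intro e he φ
    -- Every assignment in the quotient comes from a substitution of words.
    choose ψ hψ using fun a => (consequences S).mk'_surjective (φ a).down
    have hφ : ∀ a, φ a = ULift.up (ψ a : Q) := fun a => by
      rw [← Con.coe_mk', hψ]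
    rw [hlift φ ψ hφ, hlift φ ψ hφ]
    exact congrArg ULift.up ((consequences S).eq.2 (ConGen.Rel.of _ _ ⟨e, he, ψ, rfl, rfl⟩))
  have h1 := h _ hM fun a => ULift.up ((FreeMonoid.of a : Word) : Q)
  have h2 := hlift (fun a => ULift.up ((FreeMonoid.of a : Word) : Q)) FreeMonoid.of fun _ => rfl
  have h3 : ULift.up ((FreeMonoid.lift FreeMonoid.of u : Word) : Q) =
      ULift.up ((FreeMonoid.lift FreeMonoid.of v : Word) : Q) := (h2 u).symm.trans (h1.trans (h2 v))
  have h4 := ULift.up_injective h3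
  have hid : FreeMonoid.lift (FreeMonoid.of : Letter → Word) = MonoidHom.id Word :=
    FreeMonoid.lift_restrict (MonoidHom.id Word)
  rw [hid] at h4
  exact (consequences S).eq.1 h4

theorem holdsIn_var_iff {S : Set Identity} {u v : Word} :
    HoldsIn.{w} (var.{w} S) (u, v) ↔ consequences S u v :=
  ⟨consequences_of_holdsIn_var, holdsIn_var_of_consequences⟩

/-- The identity `u ≈ v` between lists of letters follows from `S`. -/
def Derives (S : Set Identity) (u v : List ℕ) : Prop :=
  consequences S (FreeMonoid.ofList u) (FreeMonoid.ofList v)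

theorem Derives.refl (S : Set Identity) (u : List ℕ) : Derives S u u := (consequences S).refl _

theorem Derives.symm {S : Set Identity} {u v : List ℕ} (h : Derives S u v) : Derives S v u :=
  (consequences S).symm h

theorem Derives.trans {S : Set Identity} {u v w : List ℕ} (h : Derives S u v)
    (h' : Derives S v w) : Derives S u w :=
  (consequences S).trans h h'

theorem Derives.append {S : Set Identity} {u v u' v' : List ℕ} (h : Derives S u v)
    (h' : Derives S u' v') : Derives S (u ++ u') (v ++ v') := by
  rw [Derives, FreeMonoid.ofList_append, FreeMonoid.ofList_append]
  exact (consequences S).mul h h'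

theorem Derives.append_right {S : Set Identity} {u v : List ℕ} (h : Derives S u v)
    (q : List ℕ) : Derives S (u ++ q) (v ++ q) := h.append (.refl S q)

theorem Derives.append_left {S : Set Identity} {u v : List ℕ} (p : List ℕ)
    (h : Derives S u v) : Derives S (p ++ u) (p ++ v) := (Derives.refl S p).append h

theorem Derives.of_mem {S : Set Identity} {e : Identity} (he : e ∈ S) (φ : ℕ → Word)
    {u v : List ℕ} (hu : FreeMonoid.lift φ e.1 = FreeMonoid.ofList u)
    (hv : FreeMonoid.lift φ e.2 = FreeMonoid.ofList v) : Derives S u v :=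
  ConGen.Rel.of _ _ ⟨e, he, φ, hu.symm, hv.symm⟩

/-! ### Deriving steps from `Phi` and `alpha` -/

theorem derives_repeat {S : Set Identity} (hS : Phi ⊆ S) (p q : List ℕ) :
    Derives S (p ++ q ++ p) (p ++ q ++ p ++ p) :=
  .of_mem (hS (by simp [Phi]) : (x 0 * y 0 * x 0, x 0 * y 0 * x 0 ^ 2) ∈ S)
    (fun i => if i = 0 then FreeMonoid.ofList p else FreeMonoid.ofList q)
    (by simp [x, y, FreeMonoid.ofList_append, mul_assoc])
    (by simp [x, y, FreeMonoid.ofList_append, pow_two, mul_assoc])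

theorem derives_squares_comm {S : Set Identity} (hS : Phi ⊆ S) (p q : List ℕ) :
    Derives S (p ++ p ++ q ++ q) (q ++ q ++ p ++ p) :=
  .of_mem (hS (by simp [Phi]) : (x 0 ^ 2 * y 0 ^ 2, y 0 ^ 2 * x 0 ^ 2) ∈ S)
    (fun i => if i = 0 then FreeMonoid.ofList p else FreeMonoid.ofList q)
    (by simp [x, y, FreeMonoid.ofList_append, pow_two, mul_assoc])
    (by simp [x, y, FreeMonoid.ofList_append, pow_two, mul_assoc])

theorem derives_square_insert {S : Set Identity} (hS : Phi ⊆ S) (p q : List ℕ) :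
    Derives S (p ++ p ++ q) (p ++ p ++ q ++ p) :=
  .of_mem (hS (by simp [Phi]) : (x 0 ^ 2 * y 0, x 0 ^ 2 * y 0 * x 0) ∈ S)
    (fun i => if i = 0 then FreeMonoid.ofList p else FreeMonoid.ofList q)
    (by simp [x, y, FreeMonoid.ofList_append, pow_two, mul_assoc])
    (by simp [x, y, FreeMonoid.ofList_append, pow_two, mul_assoc])

/-- Double the second occurrence of `a`, use the resulting square to append `a` at the end, then
undo the doubling. -/
theorem derives_concat {S : Set Identity} (hS : Phi ⊆ S) (p : List ℕ) {a : ℕ} (h : 2 ≤ p.count a) :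
    Derives S p (p ++ [a]) := by
  obtain ⟨r, s, t, rfl, -, -⟩ := exists_split_of_two_le h
  have h1 : Derives S (r ++ ([a] ++ s ++ [a]) ++ t) (r ++ ([a] ++ s ++ [a] ++ [a]) ++ t) :=
    ((derives_repeat hS [a] s).append_left r).append_right t
  have h2 : Derives S (r ++ [a] ++ s ++ ([a] ++ [a] ++ t))
      (r ++ [a] ++ s ++ ([a] ++ [a] ++ t ++ [a])) :=
    (derives_square_insert hS [a] t).append_left _
  have h3 := h1.append_right [a]
  simp only [List.append_assoc, List.cons_append, List.nil_append] at h1 h2 h3 ⊢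
  exact (h1.trans h2).trans h3.symm

theorem derives_append {S : Set Identity} (hS : Phi ⊆ S) (p : List ℕ) {z : List ℕ}
    (h : ∀ a ∈ z, 2 ≤ p.count a) :
    Derives S p (p ++ z) := by
  induction z generalizing p with
  | nil => rw [List.append_nil]; exact .refl S p
  | cons a z ih =>
    have h1 := ih (p ++ [a]) fun b hb => by
      have := h b (by simp [hb])
      rw [List.count_append]; omega
    have := (derives_concat hS p (h a (by simp))).trans h1
    simpa using this

theorem derives_insert {S : Set Identity} (hS : Phi ⊆ S) (p q : List ℕ) {z : List ℕ}
    (h : ∀ a ∈ z, 2 ≤ p.count a) :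
    Derives S (p ++ q) (p ++ z ++ q) :=
  (derives_append hS p h).append_right q

/-- Extend `p z` to `p z z z' z'`, commute the squares to `p z' z' z z`, and delete the superfluous
tail. -/
theorem derives_replace {S : Set Identity} (hS : Phi ⊆ S) (p q : List ℕ) {z z' : List ℕ}
    (h : ∀ a ∈ z ++ z', 2 ≤ (p ++ z).count a)
    (h' : ∀ a ∈ z ++ z', 2 ≤ (p ++ z').count a) :
    Derives S (p ++ z ++ q) (p ++ z' ++ q) := by
  have h1 : Derives S (p ++ z ++ q) (p ++ z ++ (z ++ z' ++ z') ++ q) :=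
    derives_insert hS (p ++ z) q fun a ha => h a (by simp at ha ⊢; tauto)
  have h2 : Derives S (p ++ z' ++ q) (p ++ z' ++ (z' ++ z ++ z) ++ q) :=
    derives_insert hS (p ++ z') q fun a ha => h' a (by simp at ha ⊢; tauto)
  have h3 := ((derives_squares_comm hS z z').append_left p).append_right q
  simp only [List.append_assoc] at h1 h2 h3 ⊢
  exact (h1.trans h3).trans h2.symm

/-- The image of the word `b s` under the substitution `x i ↦ ψ i`. -/
def substB (ψ : ℕ → List ℕ) : ℕ → List ℕ
  | 0 => []
  | s + 1 => ψ s ++ ψ (s + 1) ++ substB ψ s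

theorem lift_b {φ : ℕ → Word} {ψ : ℕ → List ℕ} {s : ℕ}
    (h : ∀ i ≤ s, φ (2 * i) = FreeMonoid.ofList (ψ i)) :
    FreeMonoid.lift φ (b s) = FreeMonoid.ofList (substB ψ s) := by
  induction s with
  | zero => rfl
  | succ s ih =>
    rw [b, map_mul, map_mul, ih fun i hi => h i (by omega)]
    simp [x, substB, h s (by omega), h (s + 1) le_rfl, FreeMonoid.ofList_append, mul_assoc]

theorem substB_congr {ψ ψ' : ℕ → List ℕ} {s : ℕ} (h : ∀ i ≤ s, ψ i = ψ' i) :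
    substB ψ s = substB ψ' s := by
  induction s with
  | zero => rfl
  | succ s ih =>
    rw [substB, substB, ih fun i hi => h i (by omega), h s (by omega), h (s + 1) le_rfl]

theorem derives_alpha {S : Set Identity} {s : ℕ} (hS : alpha (s + 1) ∈ S) (ψ : ℕ → List ℕ)
    (p q : List ℕ) : Derives S (p ++ q ++ ψ s ++ p ++ q ++ substB ψ s)
      (q ++ p ++ ψ s ++ p ++ q ++ substB ψ s) := by
  let φ : ℕ → Word := fun i => if i = 2 * (s + 1) then FreeMonoid.ofList p else
    if i = 2 * (s + 1) + 1 then FreeMonoid.ofList q else FreeMonoid.ofList (ψ (i / 2))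
  have hφ : ∀ i ≤ s, φ (2 * i) = FreeMonoid.ofList (ψ i) := fun i hi => by
    simp only [φ]
    rw [if_neg (by omega), if_neg (by omega)]
    congr 2
    omega
  have hp : φ (2 * (s + 1)) = FreeMonoid.ofList p := if_pos rfl
  have hq : φ (2 * (s + 1) + 1) = FreeMonoid.ofList q := by
    simp only [φ]
    rw [if_neg (by omega), if_pos trivial]
  refine .of_mem hS φ ?_ ?_ <;>
  · simp only [alpha, Nat.add_sub_cancel, map_mul, lift_b hφ]
    simp only [x, y, FreeMonoid.lift_eval_of, hp, hq, hφ s le_rfl, FreeMonoid.ofList_append]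

theorem exists_unmarked_prefix (D : Set ℕ) (p q : List ℕ) :
    ∃ g r, q = g ++ r ∧ (∀ a ∈ g, a ∈ p ∨ a ∉ D) ∧
      (r = [] ∨ ∃ b t, r = b :: t ∧ b ∉ p ++ g ∧ b ∈ D) := by
  induction q with
  | nil => exact ⟨[], [], rfl, by simp, Or.inl rfl⟩
  | cons a q ih =>
    by_cases ha : a ∈ p ∨ a ∉ D
    · obtain ⟨g, r, rfl, h1, h2⟩ := ih
      refine ⟨a :: g, r, rfl, by simpa [ha] using h1, h2.imp_right ?_⟩
      rintro ⟨b, t, rfl, hb, hbD⟩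
      refine ⟨b, t, rfl, ?_, hbD⟩
      simp only [List.mem_append, List.mem_cons] at hb ⊢
      rintro (h | rfl | h) <;> tauto
    · exact ⟨[], a :: q, rfl, by simp, Or.inr ⟨a, q, rfl, by simp; tauto, by tauto⟩⟩

/-- If `a` occurred once in `h`, it would be simple in `w` or separated from its next occurrence by
the divider that opens `r`. -/
theorem two_le_count_of_not_mem_dividers {w p h r : List ℕ} {n a : ℕ} (hw : w = p ++ h ++ r)
    (hr : r = [] ∨ ∃ b t, r = b :: t ∧ b ∉ p ++ h ∧ b ∈ dividers w n) (ha : a ∈ h) (hap : a ∉ p)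
    (hD : a ∉ dividers w (n + 1)) : 2 ≤ h.count a := by
  obtain ⟨h₁, h₂, rfl, hc⟩ := exists_prefix (i := 1) le_rfl (List.count_pos_iff.2 ha)
  have hh1 : a ∉ h₁ := List.count_eq_zero.1 (by omega)
  by_cases hh2 : a ∈ h₂
  · have := List.count_pos_iff.2 hh2
    rw [List.count_append, List.count_cons_self]
    omega
  exfalso
  apply hD
  by_cases har : a ∈ r
  · obtain ⟨b, t, rfl, hb, hbD⟩ := hr.resolve_left (List.ne_nil_of_mem har)
    obtain ⟨q, s, hqs, hq⟩ := exists_prefix (i := 1) le_rfl (List.count_pos_iff.2 har)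
    have hba : b ≠ a := by rintro rfl; simp at hb
    have hbq : b ∈ q := by
      rcases q with _ | ⟨c, q⟩
      · simp only [List.nil_append, List.cons.injEq] at hqs
        exact absurd hqs.1 hba
      · simp only [List.cons_append, List.cons.injEq] at hqs
        simp [hqs.1]
    refine (mem_dividers_succ_of_split (p := p ++ h₁) (q := h₂ ++ q) (r := s)
      (by simp [hw, hqs]) (by simp [hap, hh1]) ?_).2 ⟨b, by simp [hbq], ?_, hbD⟩
    · rw [List.mem_append, not_or]
      exact ⟨hh2, List.count_eq_zero.1 (by omega)⟩
    · simp only [List.mem_append, List.mem_cons, not_or] at hb ⊢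
      tauto
  · rw [mem_dividers_succ, hw]
    left
    have := List.count_eq_zero.2 hap
    have := List.count_eq_zero.2 hh2
    have := List.count_eq_zero.2 har
    simp only [List.count_append, List.count_cons_self]
    omega

/-- This builds the tail required by `alpha (s + 1)`. The words `ψ` do not depend on `p'`, so the
same tail serves both orders of the two swapped letters. -/
theorem exists_derives_substB {S : Set Identity} (hS : Phi ⊆ S) {s : ℕ} {p z q : List ℕ}
    (hz : ∀ a ∈ z, a ∈ p ∨ a ∉ dividers (p ++ z ++ q) s) :
    ∃ ψ : ℕ → List ℕ, ∀ p' : List ℕ, (∀ a, min 2 ((p ++ z).count a) ≤ p'.count a) →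
      Derives S (p' ++ q) (p' ++ ψ s ++ z ++ substB ψ s) := by
  induction s generalizing z q with
  | zero =>
    refine ⟨fun _ => q, fun p' hp' => ?_⟩
    rw [substB, List.append_nil]
    refine derives_append hS _ fun a ha => ?_
    have h1 := hp' a
    have h2 := List.count_pos_iff.2 ha
    have h3 := hz a ha
    rw [mem_dividers_zero, ← List.count_pos_iff] at h3
    simp only [List.count_append] at h1 h3 ⊢
    omega
  | succ s ih =>
    -- Here `g` is the rest of the `s`-block after `z` and becomes the value of `x (s + 1)`;
    -- induction applies to `z ++ g`. Letters of `z` occur twice by the end of `p' ++ g`, so `z` can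
    -- be moved from behind `ψ s` to the front of it.
    obtain ⟨g, r, rfl, hg, hr⟩ := exists_unmarked_prefix (dividers (p ++ z ++ q) s) (p ++ z) q
    rw [← List.append_assoc] at hz hg hr
    have hzg : ∀ a ∈ z ++ g, a ∈ p ∨ a ∉ dividers (p ++ (z ++ g) ++ r) s := by
      intro a ha
      rw [← List.append_assoc]
      have hzs : ∀ a ∈ z, a ∈ p ∨ a ∉ dividers (p ++ z ++ g ++ r) s := fun a ha =>
        (hz a ha).imp_right fun h h' => h (dividers_succ_of_mem h')
      rcases List.mem_append.1 ha with ha | ha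
      · exact hzs a ha
      · rcases hg a ha with h | h
        · rcases List.mem_append.1 h with h | h
          · exact Or.inl h
          · exact hzs a h
        · exact Or.inr h
    obtain ⟨ψ, hψ⟩ := ih hzg
    refine ⟨Function.update ψ (s + 1) g, fun p' hp' => ?_⟩
    have h1 := hψ (p' ++ g) fun a => by
      have := hp' a
      simp only [List.count_append] at this ⊢
      omega
    have hb : substB (Function.update ψ (s + 1) g) s = substB ψ s :=
      substB_congr fun i hi => Function.update_of_ne (by omega) _ _
    rw [substB, hb, Function.update_self, Function.update_of_ne (by omega)]
    have hz2 : ∀ a ∈ z, 2 ≤ (p' ++ g).count a := by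
      intro a ha
      have h2 := hp' a
      have h3 := List.count_pos_iff.2 ha
      by_cases hap : a ∈ p
      · have := List.count_pos_iff.2 hap
        simp only [List.count_append] at h2 ⊢
        omega
      · have h4 := two_le_count_of_not_mem_dividers (w := p ++ z ++ g ++ r) (p := p) (h := z ++ g)
          (r := r) (n := s) (a := a) (by simp) (by simpa using hr) (by simp [ha]) hap
          ((hz a ha).resolve_left hap)
        simp only [List.count_append] at h2 h4 ⊢
        omega
    have h2 := derives_insert hS (p' ++ g ++ ψ s) (g ++ substB ψ s) (z := z) fun a ha => by
      have := hz2 a ha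
      rw [List.count_append]
      omega
    have h3 := derives_insert hS (p' ++ g) (ψ s ++ g ++ substB ψ s) (z := z) hz2
    simp only [List.append_assoc] at h1 h2 h3 ⊢
    exact (h1.trans h2.symm).trans h3

theorem Step.derives_alpha {n : ℕ} {u v : List ℕ} (h : Step n u v) :
    Derives (Phi ∪ {alpha (n + 1)}) u v := by
  have hS : Phi ⊆ Phi ∪ {alpha (n + 1)} := Set.subset_union_left
  rcases h with ⟨p, q, a, ha⟩ | ⟨p, q, a, b, ha, hb⟩
  · simpa using derives_insert hS p q (z := [a]) (by simpa using ha)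
  · obtain ⟨ψ, hψ⟩ := exists_derives_substB hS (s := n) (p := p) (z := [a, b]) (q := q)
      (by simpa using ⟨ha, hb⟩)
    have h1 := hψ (p ++ [a, b]) fun _ => by omega
    have h2 := hψ (p ++ [b, a]) fun c => by
      have := ((List.Perm.swap b a []).append_left p).count_eq c
      omega
    have h3 := (MonoidWords.derives_alpha (S := Phi ∪ {alpha (n + 1)}) (s := n) (by simp) ψ
      [a] [b]).append_left p
    simp only [List.append_assoc, List.cons_append, List.nil_append] at h1 h2 h3
    exact (h1.trans h3).trans h2.symm

/-- In the part of the block from `a b` up to the next divider, no letter new after `p` is an `(n +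
1)`-divider either, so each letter occurs twice by the end of the block and `derives_replace`
applies. -/
theorem Step.derives_of_stable {n : ℕ} {u v : List ℕ} (h : Step n u v)
    (hn : dividers u n = dividers u (n + 1)) : Derives Phi u v := by
  rcases h with ⟨p, q, a, ha⟩ | ⟨p, q, a, b, ha, hb⟩
  · simpa using derives_insert subset_rfl p q (z := [a]) (by simpa using ha)
  · obtain ⟨g, r, rfl, hg, hr⟩ :=
      exists_unmarked_prefix (dividers (p ++ a :: b :: q) n) (p ++ [a, b]) q
    set w := p ++ a :: b :: (g ++ r) with hw
    have hcount : ∀ c ∈ a :: b :: g, 2 ≤ (p ++ a :: b :: g).count c := by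
      intro c hc
      by_cases hcp : c ∈ p
      · have := List.count_pos_iff.2 hcp
        have := List.count_pos_iff.2 hc
        rw [List.count_append]
        omega
      · have hcD : c ∉ dividers w n := by
          simp only [List.mem_cons, List.mem_append, List.not_mem_nil, or_false] at hc hg
          rcases hc with rfl | rfl | hc
          · tauto
          · tauto
          · rcases hg c hc with (h | rfl | rfl) | h <;> tauto
        have := two_le_count_of_not_mem_dividers (w := w) (p := p) (h := a :: b :: g) (r := r)
          (n := n) (a := c) (by simp [hw]) (by simpa using hr) hc hcp (hn ▸ hcD)
        rw [List.count_append]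
        omega
    have hperm : ∀ c, (p ++ b :: a :: g).count c = (p ++ a :: b :: g).count c := fun c =>
      ((List.Perm.swap a b g).append_left p).count_eq c
    have := derives_replace (S := Phi) subset_rfl p r (z := a :: b :: g) (z' := b :: a :: g)
      (fun c hc => hcount c (by simp at hc ⊢; tauto))
      (fun c hc => by rw [hperm]; exact hcount c (by simp at hc ⊢; tauto))
    simpa [hw] using this

theorem derives_alpha_of_eqvGen {n : ℕ} {u v : List ℕ} (h : Relation.EqvGen (Step n) u v) :
    Derives (Phi ∪ {alpha (n + 1)}) u v := by
  induction h with
  | rel _ _ h => exact h.derives_alpha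
  | refl u => exact .refl _ u
  | symm _ _ _ ih => exact ih.symm
  | trans _ _ _ _ _ ih ih' => exact ih.trans ih'

theorem derives_of_eqvGen_of_stable {n : ℕ} {u v : List ℕ} (h : Relation.EqvGen (Step n) u v)
    (hn : dividers u n = dividers u (n + 1)) : Derives Phi u v := by
  induction h with
  | rel _ _ h => exact h.derives_of_stable hn
  | refl u => exact .refl _ u
  | symm u v h ih =>
    have := (eqvGen_step_invariant h).1
    exact (ih (by rw [this n (by omega), this (n + 1) le_rfl, hn])).symm
  | trans u v w h _ ih ih' =>
    have := (eqvGen_step_invariant h).1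
    exact (ih hn).trans (ih' (by rw [← this n (by omega), ← this (n + 1) le_rfl, hn]))


/-! ### The identities as chains of steps -/

theorem eqvGen_step_insert {n : ℕ} {p z : List ℕ} (q : List ℕ) (h : ∀ a ∈ z, 2 ≤ p.count a) :
    Relation.EqvGen (Step n) (p ++ q) (p ++ z ++ q) := by
  induction z generalizing p with
  | nil => rw [List.append_nil]; exact .refl _
  | cons a z ih =>
    have h1 := Step.insert (n := n) p (z ++ q) a (h a (by simp))
    have h2 := ih (p := p) fun b hb => h b (by simp [hb])
    simp only [List.append_assoc, List.cons_append] at h1 h2 ⊢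
    exact h2.trans _ _ _ (.rel _ _ h1)

theorem not_mem_dividers_succ {w p z q : List ℕ} {n a : ℕ} (hw : w = p ++ z ++ q)
    (hz : ∀ b ∈ z, b ∈ p ∨ b ∉ dividers w n) (ha : 2 ≤ z.count a) (hap : a ∉ p) :
    a ∉ dividers w (n + 1) := by
  obtain ⟨r, s, t, rfl, hr, hs⟩ := exists_split_of_two_le ha
  rw [mem_dividers_succ_of_split (p := p ++ r) (q := s) (r := t ++ q) (by simp [hw])
    (by simp [hap, hr]) hs]
  rintro ⟨b, hb, hbp, hbD⟩
  rcases hz b (by simp only [List.mem_append, List.mem_cons] at hb ⊢; tauto) with h | h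
  · exact hbp (List.mem_append_left _ h)
  · exact h hbD

theorem not_mem_dividers_zero {w p z q : List ℕ} {a : ℕ} (hw : w = p ++ z ++ q)
    (ha : 2 ≤ z.count a) : a ∉ dividers w 0 := by
  rw [mem_dividers_zero, hw]
  simp only [List.count_append]
  omega

theorem not_mem_dividers_of_two_le {w p z q : List ℕ} (hw : w = p ++ z ++ q)
    (hz : ∀ a ∈ z, 2 ≤ z.count a) (n : ℕ) : ∀ a ∈ z, a ∈ p ∨ a ∉ dividers w n := by
  induction n with
  | zero => exact fun a ha => Or.inr (not_mem_dividers_zero hw (hz a ha))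
  | succ n ih =>
    exact fun a ha => or_iff_not_imp_left.2 fun hap => not_mem_dividers_succ hw ih (hz a ha) hap

/-- Each further pair of factors of `substB` pushes the argument up one level: repeated letters
inside an `s`-block cannot become `(s + 1)`-dividers. -/
theorem not_mem_dividers_substB {ψ : ℕ → List ℕ} {s : ℕ} {w p z₁ z₂ q : List ℕ}
    (hw : w = p ++ (z₁ ++ ψ s ++ z₂) ++ substB ψ s ++ q)
    (hz : ∀ a ∈ z₁ ++ z₂, a ∈ p ∨ 2 ≤ (z₁ ++ ψ s ++ z₂).count a) :
    ∀ a ∈ z₁, a ∈ p ∨ a ∉ dividers w s := by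
  induction s generalizing z₁ z₂ with
  | zero =>
    intro a ha
    refine (hz a (by simp [ha])).imp_right fun h => ?_
    exact not_mem_dividers_zero (by simpa [List.append_assoc] using hw) h
  | succ s ih =>
    -- The copy of `ψ (s + 1)` following `ψ s` in `substB` supplies the second occurrences for the
    -- enlarged `z₁`.
    have h1 := ih (z₁ := z₁ ++ ψ (s + 1) ++ z₂) (z₂ := ψ (s + 1)) (by simp [hw, substB])
      fun a ha => by
        by_cases h : a ∈ z₁ ++ z₂
        · refine (hz a h).imp_right fun h2 => ?_
          rw [List.count_append, List.count_append]
          omega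
        · have h2 : a ∈ ψ (s + 1) := by
            simp only [List.mem_append] at ha h ⊢
            tauto
          right
          have := List.count_pos_iff.2 h2
          simp only [List.count_append]
          omega
    intro a ha
    refine or_iff_not_imp_left.2 fun hap => ?_
    exact not_mem_dividers_succ (z := z₁ ++ ψ (s + 1) ++ z₂) (p := p)
      (q := substB ψ (s + 1) ++ q) (by simp [hw]) h1
      ((hz a (by simp [ha])).resolve_left hap) hap

/-- Equivalence under `Step n` in all contexts. -/
def stepCon (n : ℕ) : Con Word where
  r u v := ∀ p q : List ℕ,
    Relation.EqvGen (Step n) (p ++ u.toList ++ q) (p ++ v.toList ++ q)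
  iseqv := ⟨fun _ _ _ => .refl _, fun h p q => .symm _ _ (h p q),
    fun h h' p q => .trans _ _ _ (h p q) (h' p q)⟩
  mul' {u v u' v'} h h' p q := by
    have h1 := h p (u'.toList ++ q)
    have h2 := h' (p ++ v.toList) q
    simp only [FreeMonoid.toList_mul, List.append_assoc] at h1 h2 ⊢
    exact h1.trans _ _ _ h2

theorem toList_lift_b (φ : ℕ → Word) (s : ℕ) : (FreeMonoid.lift φ (b s)).toList =
    substB (fun i => (φ (2 * i)).toList) s := by
  rw [lift_b (ψ := fun i => (φ (2 * i)).toList) fun _ _ => rfl]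
  rfl

theorem consequences_le_stepCon (n : ℕ) : consequences (Phi ∪ {alpha (n + 1)}) ≤ stepCon n := by
  refine Con.conGen_le.2 ?_
  rintro _ _ ⟨e, he, φ, rfl, rfl⟩ p q
  simp only [Phi, Set.mem_union, Set.mem_insert_iff, Set.mem_singleton_iff] at he
  rcases he with (rfl | rfl | rfl) | rfl
  · have := eqvGen_step_insert (n := n) (p := p ++ ((φ 0).toList ++ (φ 1).toList ++ (φ 0).toList))
      (z := (φ 0).toList) q fun a ha => by
        have := List.count_pos_iff.2 ha
        simp only [List.count_append]
        omega
    simpa [x, y, pow_two] using this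
  · have := eqvGen_step_perm (n := n) (List.perm_append_comm (l₁ := (φ 0).toList ++ (φ 0).toList)
      (l₂ := (φ 1).toList ++ (φ 1).toList)) p q
      (not_mem_dividers_of_two_le rfl (fun a ha => by
        have := List.count_pos_iff.2 ha
        simp only [List.count_append] at this ⊢
        omega) n)
    simpa [x, y, pow_two] using this
  · have := eqvGen_step_insert (n := n) (p := p ++ ((φ 0).toList ++ (φ 0).toList ++ (φ 1).toList))
      (z := (φ 0).toList) q fun a ha => by
        have := List.count_pos_iff.2 ha
        simp only [List.count_append]
        omega
    simpa [x, y, pow_two] using this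
  · set ψ : ℕ → List ℕ := fun i => (φ (2 * i)).toList with hψ
    set u := (φ (2 * (n + 1))).toList with hu
    set v := (φ (2 * (n + 1) + 1)).toList with hv
    have := eqvGen_step_perm (n := n) (List.perm_append_comm (l₁ := u) (l₂ := v)) p
      (ψ n ++ (u ++ v) ++ substB ψ n ++ q)
      (not_mem_dividers_substB (ψ := ψ) (s := n) (z₂ := u ++ v) (q := q) (by simp) fun a ha => by
        right
        have := List.count_pos_iff.2 ha
        simp only [List.count_append] at this ⊢
        omega)
    simp only [alpha, Nat.add_sub_cancel, map_mul, FreeMonoid.toList_mul, toList_lift_b]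
    simp only [x, y, FreeMonoid.lift_eval_of]
    simpa [hψ, hu, hv] using this

/-! ### Assembling the equivalences -/

theorem consequences_alpha_iff {n : ℕ} {u v : Word} :
    consequences (Phi ∪ {alpha (n + 1)}) u v ↔
      Agree (dividers u.toList n) (dividers v.toList n) u.toList v.toList := by
  constructor
  · intro h
    have h1 := consequences_le_stepCon n h [] []
    simp only [List.nil_append, List.append_nil] at h1
    exact (eqvGen_step_invariant h1).2
  · exact fun h => derives_alpha_of_eqvGen (eqvGen_step_of_agree h)

theorem consequences_Phi_iff {u v : Word} :
    consequences Phi u v ↔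
      ∀ n, Agree (dividers u.toList n) (dividers v.toList n) u.toList v.toList := by
  constructor
  · intro h n
    refine consequences_alpha_iff.1 ?_
    have : consequences Phi ≤ consequences (Phi ∪ {alpha (n + 1)}) :=
      Con.conGen_mono fun _ _ ⟨e, he, h⟩ => ⟨e, Or.inl he, h⟩
    exact this h
  · intro h
    -- Only one level is needed here: the one at which the dividers of `u` stabilise.
    obtain ⟨n, hn⟩ := exists_dividers_stable u.toList
    exact derives_of_eqvGen_of_stable (eqvGen_step_of_agree (h n)) hn

theorem agree_iff {n : ℕ} {u v : Word} :
    Agree (dividers u.toList n) (dividers v.toList n) u.toList v.toList ↔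
      SameSimpMul u v ∧ SameRestrictors n u v := by
  have hcount : SameSimpMul u v ↔
      ∀ a, min 2 (u.toList.count a) = min 2 (v.toList.count a) := by
    simp only [SameSimpMul, sim, mul, occ, Set.ext_iff, Set.mem_ofPred_eq, ← forall_and]
    refine forall_congr' fun a => ?_
    omega
  rw [hcount]
  simp only [SameRestrictors, restrictor_eq_restrict, con, occ, Set.mem_ofPred_eq]
  constructor
  · exact fun h => ⟨fun a => (h a).1, fun a _ i hi hu _ => (h a).2 i hi hu⟩
  · rintro ⟨h1, h2⟩ a
    have := h1 a
    exact ⟨h1 a, fun i hi hu => h2 a (by omega) i hi hu (by omega)⟩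

end MonoidWords

theorem proposition6p12 (u v : MonoidWords.Word) (huv : u ≠ v) :
    (∀ k : ℕ, 1 ≤ k →
      (MonoidWords.HoldsIn (MonoidWords.F.{w} k) (u, v) ↔
        MonoidWords.SameSimpMul u v ∧ MonoidWords.SameRestrictors (k - 1) u v)) ∧
    (MonoidWords.HoldsIn MonoidWords.K.{w} (u, v) ↔
      MonoidWords.SameSimpMul u v ∧
        ∀ l : ℕ, 1 ≤ l → MonoidWords.SameRestrictors (l - 1) u v) := by
  constructor
  · intro k hk
    obtain ⟨n, rfl⟩ := Nat.exists_eq_add_of_le' hk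
    rw [MonoidWords.F, MonoidWords.holdsIn_var_iff, MonoidWords.consequences_alpha_iff,
      MonoidWords.agree_iff, Nat.add_sub_cancel]
  · rw [MonoidWords.K, MonoidWords.holdsIn_var_iff, MonoidWords.consequences_Phi_iff]
    simp only [MonoidWords.agree_iff]
    constructor
    · exact fun h => ⟨(h 0).1, fun l _ => (h (l - 1)).2⟩
    · exact fun h n => ⟨h.1, h.2 (n + 1) (by omega)⟩
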